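/- Let $\Sigma$ be a finite set of real $n\times n$ matrices. For $T\subseteq\Sigma$ put $N_T=\bigcap_{A\in T}\ker(I-A)$ and $R_T=\operatorname{span}\bigcup_{A\in T}\operatorname{range}(I-A)$. Call $\Sigma$ *CP* if for every sequence $B_1,B_2,\dots$ in $\Sigma$ both $\lim_m B_m\cdots B_1$ and $\lim_m B_1\cdots B_m$ exist, and $\mathbb R^n=N_T\oplus R_T$ for every $T\subseteq\Sigma$. Let $\Sigma$ be a finite CP set, $R$ a linearly ordered set, and $A:R\to\Sigma$ any map. For $S\subseteq R$ the continuous product $M(S)=\prod_{r\in S}A(r)$ is defined iteratively on the number of elements of $A(S)$. For a finite set $S=\{s_1<\dots<s_k\}$ put $M(S)=A(s_1)\cdots A(s_k)$ (the identity if $S=\emptyset$). For general $S$, an interval of $S$ is a subset of $S$ without holes (if $a<g<b$ with $a,b$ in the subset and $g\in S$, then $g$ is in the subset). An interval $T$ is complete if $A(T)=A(S)$, and incomplete otherwise. If $S\ne\emptyset$ has arbitrarily large finite families of pairwise disjoint nonempty complete intervals, $M(S)$ is the projection onto $N_{A(S)}$ along $R_{A(S)}$. Otherwise $M(S)=M(T_1)\cdots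 M(T_m)$ for any partition of $S$ into consecutive incomplete intervals $T_1<\dots<T_m$. For a linearly ordered set $Q$ and an arbitrary matrix-valued map $B$ on $Q$, the continuous product of $B$ over $S'\subseteq Q$ is the limit, if it exists, of the ordered finite products $B(q_1)\cdots B(q_k)$ over the finite subsets $\{q_1<\dots<q_k\}$ of $S'$, directed by inclusion. **Theorem.** Let $\Sigma$, $R$, $A$ be as above. Then the iterative procedure assigns exactly one matrix $M(S)$ to every $S\subseteq R$. Let $F:R\to Q$ be a monotone (non-decreasing) map to a linearly ordered set $Q$, and put $M'(q)=M(F^{-1}(q))$ for $q\in Q$. Then for every subset $S'\subseteq Q$ the continuous product $M'(S')$ of $M'$ over $S'$ exists and $$M'(S')=M(F^{-1}(S')).$$ Moreover, whenever the values of $M'$ on $S'$ lie in a finite CP set, the iterative procedure applied to $M'$ on $S'$ also yields exactly one matrix, and it is again $M(F^{-1}(S'))$. -/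

import Mathlib

open Filter Topology

namespace ContinuousProduct

/-- Real square matrices of size `n` (with the topology of entrywise convergence, which is the
topology of every matrix norm). -/
abbrev Mat (n : ℕ) : Type := Matrix (Fin n) (Fin n) ℝ

/-- Left convergent products: for every sequence `s` in `Sig`, the products
`s (m-1) * ... * s 1 * s 0` converge as `m → ∞`. -/
def IsLCP {n : ℕ} (Sig : Set (Mat n)) : Prop :=
  ∀ s : ℕ → Mat n, (∀ i, s i ∈ Sig) →
    ∃ L : Mat n, Tendsto (fun m : ℕ => ((List.range m).reverse.map s).prod) atTop (𝓝 L)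

/-- Right convergent products: for every sequence `s` in `Sig`, the products
`s 0 * s 1 * ... * s (m-1)` converge as `m → ∞`. -/
def IsRCP {n : ℕ} (Sig : Set (Mat n)) : Prop :=
  ∀ s : ℕ → Mat n, (∀ i, s i ∈ Sig) →
    ∃ L : Mat n, Tendsto (fun m : ℕ => ((List.range m).map s).prod) atTop (𝓝 L)

/-- The common fixed space: the intersection of the null spaces of `1 - A`, `A ∈ T`. -/
def fixedSpace {n : ℕ} (T : Set (Mat n)) : Submodule ℝ (Fin n → ℝ) :=
  ⨅ A ∈ T, LinearMap.ker (Matrix.toLin' (1 - A))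

/-- The span of the ranges of `1 - A`, `A ∈ T`. -/
def rangeSpace {n : ℕ} (T : Set (Mat n)) : Submodule ℝ (Fin n → ℝ) :=
  ⨆ A ∈ T, LinearMap.range (Matrix.toLin' (1 - A))

/-- Transversality: the space is the direct sum of the fixed space and of the range space of each
subset of `Sig`. -/
def IsTransversal {n : ℕ} (Sig : Set (Mat n)) : Prop :=
  ∀ T : Set (Mat n), T ⊆ Sig → IsCompl (fixedSpace T) (rangeSpace T)

/-- A set of matrices is CP if it is LCP, RCP and transversal. -/
structure IsCP {n : ℕ} (Sig : Set (Mat n)) : Prop where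
  lcp : IsLCP Sig
  rcp : IsRCP Sig
  transversal : IsTransversal Sig

/-- The matrix `P` is the projection onto the common fixed space of `T` along the range space
of `T`. -/
def IsProjection {n : ℕ} (T : Set (Mat n)) (P : Mat n) : Prop :=
  ∀ x : Fin n → ℝ, P.mulVec x ∈ fixedSpace T ∧ x - P.mulVec x ∈ rangeSpace T

/-- The product `A s₁ * ... * A sₖ` over a finite set `G = {s₁ < ... < sₖ}`. -/
def finProd {n : ℕ} {R : Type*} [LinearOrder R] (A : R → Mat n) (G : Finset R) : Mat n :=
  ((G.sort (· ≤ ·)).map A).prod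

/-- `T` is an interval of the linearly ordered set `S`, that is, a subset without holes. -/
def IsInterval {R : Type*} [LinearOrder R] (S T : Set R) : Prop :=
  T ⊆ S ∧ ∀ a ∈ T, ∀ b ∈ T, ∀ g ∈ S, a < g → g < b → g ∈ T

/-- There are `m` pairwise disjoint nonempty intervals of `S` that are complete: `A` takes on each
of them all the values that it takes on `S`. -/
def HasCompleteIntervals {n : ℕ} {R : Type*} [LinearOrder R] (A : R → Mat n) (S : Set R)
    (m : ℕ) : Prop :=
  ∃ T : Fin m → Set R, (∀ i, IsInterval S (T i)) ∧ (∀ i, (T i).Nonempty) ∧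
    (∀ i j, i ≠ j → Disjoint (T i) (T j)) ∧ ∀ i, A '' (T i) = A '' S

/-- The maximal number (possibly `⊤`) of disjoint complete intervals of `S`. -/
noncomputable def completeIndex {n : ℕ} {R : Type*} [LinearOrder R] (A : R → Mat n)
    (S : Set R) : ℕ∞ :=
  ⨆ (m : ℕ) (_ : HasCompleteIntervals A S m), (m : ℕ∞)

/-- `IsContProd A S X`: the iterative procedure, over the number of values that `A` takes on `S`,
yields the matrix `X` as a continuous product of `A` over `S`.
* Over a finite set it is the ordinary ordered product.
* If `S` has arbitrarily many disjoint complete intervals, it is the projection onto the common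
  fixed space of the values of `A` on `S` along their range space.
* Otherwise `S` is cut into finitely many consecutive incomplete intervals `T 0 < T 1 < ...`, on
  each of which `A` takes fewer values, and the products over these are multiplied in order. -/
inductive IsContProd {n : ℕ} {R : Type*} [LinearOrder R] (A : R → Mat n) : Set R → Mat n → Prop
  | finite (G : Finset R) : IsContProd A (G : Set R) (finProd A G)
  | proj (S : Set R) (P : Mat n) (hS : S.Nonempty) (hI : completeIndex A S = ⊤)
      (hP : IsProjection (A '' S) P) : IsContProd A S P
  | partition (S : Set R) (hI : completeIndex A S ≠ ⊤) (m : ℕ) (T : Fin m → Set R)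
      (X : Fin m → Mat n) (hU : (⋃ i, T i) = S)
      (hlt : ∀ i j, i < j → ∀ a ∈ T i, ∀ b ∈ T j, a < b)
      (hinc : ∀ i, A '' (T i) ≠ A '' S)
      (hX : ∀ i, IsContProd A (T i) (X i)) : IsContProd A S (List.ofFn X).prod

open Classical in
/-- The continuous product `M(S)` of `A` over `S` given by the iterative procedure. -/
noncomputable def contProd {n : ℕ} {R : Type*} [LinearOrder R] (A : R → Mat n) (S : Set R) :
    Mat n :=
  if h : ∃ X : Mat n, IsContProd A S X then h.choose else 0

/-- `X` is the continuous product of an arbitrary matrix-valued function `B` over `S` as a limit: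
the finite ordered products of `B` over the finite subsets of `S`, directed by inclusion,
converge to `X`. -/
def HasLimitProd {n : ℕ} {Q : Type*} [LinearOrder Q] (B : Q → Mat n) (S : Set Q) (X : Mat n) :
    Prop :=
  Tendsto (fun G : Finset S => finProd (fun q : S => B q) G) atTop (𝓝 X)

end ContinuousProduct

/-! The point is that every matrix produced by the iterative procedure is the limit of the finite
ordered products, directed by inclusion (`IsContProd.hasLimitProd`). Uniqueness is then uniqueness
of limits, and the formula for `M'` is a statement about iterated limits. Limits over consecutive
sets multiply, so finite unions of fibres are understood, and a closed-neighbourhood argument passes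
to arbitrary `S'` (`HasLimitProd.of_preimage`).

The analytic core is the projection case. A finite set whose infinite left products converge
generates a bounded monoid. If every letter of `V` recurs infinitely often, the limit is fixed by
`V`, and transversality identifies it with the projection `P`. Compactness makes this uniform: every
product of sufficiently many complete words is close to `P` (`exists_length_flatten_near`). A finite
set of points witnessing many complete intervals therefore forces all larger finite products near
`P`.

Existence is by induction on the number of values: if complete blocks cannot be cut off
indefinitely, cutting greedily gives finitely many incomplete intervals
(`hasIncompletePartition_of_not_hasBlocks`). -/

namespace ContinuousProduct

/-! ### Infinite words and left products -/

/-- A strictly growing chain of lists consists of initial segments of one infinite sequence. -/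
theorem exists_seq_of_chain {α : Type*} (l : ℕ → List α)
    (h : ∀ k, ∃ t : List α, t ≠ [] ∧ l (k + 1) = l k ++ t) :
    ∃ s : ℕ → α, ∀ k, k ≤ (l k).length ∧ l k = (List.range (l k).length).map s := by
  have hlen : ∀ k, k ≤ (l k).length := by
    intro k
    induction k with
    | zero => simp
    | succ k ih =>
      obtain ⟨t, ht, e⟩ := h k
      have : 0 < t.length := List.length_pos_iff.2 ht
      rw [e, List.length_append]
      omega
  have hpre : ∀ k j, l k <+: l (k + j) := by
    intro k j
    induction j with
    | zero => exact List.prefix_refl _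
    | succ j ih =>
      obtain ⟨t, -, e⟩ := h (k + j)
      exact ih.trans ⟨t, by rw [← add_assoc, e]⟩
  refine ⟨fun i => (l (i + 1))[i]'(hlen (i + 1)), fun k => ⟨hlen k, ?_⟩⟩
  refine List.ext_getElem (by simp) fun i h₁ h₂ => ?_
  simp only [List.getElem_map, List.getElem_range]
  rcases le_total k (i + 1) with hk | hk
  · obtain ⟨j, hj⟩ := Nat.exists_eq_add_of_le hk
    have := hpre k j
    rw [← hj] at this
    exact this.getElem h₁
  · obtain ⟨j, hj⟩ := Nat.exists_eq_add_of_le hk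
    have := hpre (i + 1) j
    rw [← hj] at this
    exact (this.getElem (hlen (i + 1))).symm

/-- The product `c (m - 1) * ... * c 1 * c 0`. -/
def leftProd {M : Type*} [Monoid M] (c : ℕ → M) (m : ℕ) : M :=
  ((List.range m).reverse.map c).prod

@[simp] theorem leftProd_zero {M : Type*} [Monoid M] (c : ℕ → M) : leftProd c 0 = 1 := rfl

theorem leftProd_succ {M : Type*} [Monoid M] (c : ℕ → M) (m : ℕ) :
    leftProd c (m + 1) = c m * leftProd c m := by
  simp [leftProd, List.range_succ]

theorem leftProd_eq_of_range {M : Type*} [Monoid M] {c : ℕ → M} {l : List M}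
    (h : l = (List.range l.length).map c) : leftProd c l.length = l.reverse.prod := by
  conv_rhs => rw [h]
  rw [leftProd, List.map_reverse]

/-! ### Boundedness and uniform convergence of left products -/

section Algebra

variable {E : Type*} [NormedRing E]

/-- If the monoid generated by `C` is bounded and all infinite left products in `C` converge to
the same limit, fixed by `C`, then so do, approximately, the infinite left products in the closure
of `C`. -/
theorem exists_leftProd_near {C : Set E} {K : ℝ}
    (hK : ∀ w ∈ Submonoid.closure C, ‖w‖ ≤ K) {P : E}
    (hlim : ∀ c : ℕ → E, (∀ i, c i ∈ C) → Tendsto (leftProd c) atTop (𝓝 P))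
    {d : ℕ → E} (hd : ∀ i, d i ∈ closure C) {ε : ℝ} (hε : 0 < ε) :
    ∃ m, ‖leftProd d m - P‖ < ε := by
  have hK0 : 0 ≤ K := (norm_nonneg _).trans (hK 1 (one_mem _))
  -- The replacement errors below add up to at most `2 * δ`, amplified by at most `K`; this keeps
  -- the total within `ε / 2`.
  set δ : ℝ := ε / (4 * (K + 1)) with hδ
  have hδ0 : 0 < δ := by positivity
  -- The error at place `i` is weighted by the product of the `d`'s to its right, which is known
  -- when `c i` is chosen; so the weighted errors can be made geometric.
  have hex : ∀ i, ∃ c ∈ C, ‖c - d i‖ * ‖leftProd d i‖ ≤ δ * (1 / 2) ^ i := by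
    intro i
    have hpos : 0 < δ * (1 / 2) ^ i / (‖leftProd d i‖ + 1) := by positivity
    obtain ⟨c, hc, hcd⟩ := Metric.mem_closure_iff.1 (hd i) _ hpos
    refine ⟨c, hc, ?_⟩
    rw [dist_comm, dist_eq_norm] at hcd
    calc ‖c - d i‖ * ‖leftProd d i‖
        ≤ δ * (1 / 2) ^ i / (‖leftProd d i‖ + 1) * (‖leftProd d i‖ + 1) := by
          gcongr; linarith
      _ = δ * (1 / 2) ^ i := by field_simp
  choose c hc hcd using hex
  -- Allowing any left factor `w` lets the induction absorb `c m` into it, so `K` enters each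
  -- telescoping term only once.
  have key : ∀ m, ∀ w ∈ Submonoid.closure C,
      ‖w * (leftProd c m - leftProd d m)‖ ≤ K * (2 * δ * (1 - (1 / 2) ^ m)) := by
    intro m
    induction m with
    | zero => intro w hw; simp
    | succ m ih =>
      intro w hw
      have e : w * (leftProd c (m + 1) - leftProd d (m + 1)) =
          (w * c m) * (leftProd c m - leftProd d m) + w * ((c m - d m) * leftProd d m) := by
        rw [leftProd_succ, leftProd_succ]; noncomm_ring
      rw [e]
      have h1 := ih (w * c m) (mul_mem hw (Submonoid.subset_closure (hc m)))
      have h2 : ‖w * ((c m - d m) * leftProd d m)‖ ≤ K * (δ * (1 / 2) ^ m) :=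
        (norm_mul_le _ _).trans (mul_le_mul (hK w hw) ((norm_mul_le _ _).trans (hcd m))
          (norm_nonneg _) hK0)
      refine (norm_add_le _ _).trans ((add_le_add h1 h2).trans (le_of_eq ?_))
      rw [pow_succ]; ring
  obtain ⟨m, hm⟩ := (((tendsto_iff_norm_sub_tendsto_zero.1 (hlim c hc)).eventually_lt_const
    (half_pos hε))).exists
  refine ⟨m, ?_⟩
  have h1 := key m 1 (one_mem _)
  rw [one_mul] at h1
  have h2 : K * (2 * δ * (1 - (1 / 2) ^ m)) ≤ ε / 2 := by
    have : (0 : ℝ) < (1 / 2) ^ m := by positivity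
    have h3 : 2 * δ * (1 - (1 / 2) ^ m) ≤ 2 * δ := mul_le_of_le_one_right (by linarith) (by linarith)
    calc K * (2 * δ * (1 - (1 / 2) ^ m)) ≤ K * (2 * δ) := mul_le_mul_of_nonneg_left h3 hK0
      _ ≤ (K + 1) * (2 * δ) := by gcongr; linarith
      _ = ε / 2 := by rw [hδ]; field_simp; ring
  calc ‖leftProd d m - P‖ = ‖(leftProd c m - P) - (leftProd c m - leftProd d m)‖ := by
        congr 1; abel
    _ ≤ _ := norm_sub_le _ _
    _ < ε := by linarith

variable [NormedAlgebra ℝ E] [FiniteDimensional ℝ E]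

/-- The elements with a bounded orbit under left multiplication by a monoid. -/
def boundedOrbit (M : Submonoid E) : Submodule ℝ E where
  carrier := {x | ∃ K : ℝ, ∀ w ∈ M, ‖w * x‖ ≤ K}
  add_mem' := by
    rintro x y ⟨K, hK⟩ ⟨L, hL⟩
    refine ⟨K + L, fun w hw => ?_⟩
    rw [mul_add]
    exact (norm_add_le _ _).trans (add_le_add (hK w hw) (hL w hw))
  zero_mem' := ⟨0, by simp⟩
  smul_mem' := by
    rintro a x ⟨K, hK⟩
    refine ⟨‖a‖ * K, fun w hw => ?_⟩
    rw [mul_smul_comm, norm_smul]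
    exact mul_le_mul_of_nonneg_left (hK w hw) (norm_nonneg _)

/-- Pointwise bounded orbits on a finite-dimensional, hence complete, space are uniformly bounded by
Banach–Steinhaus. -/
theorem exists_uniform_bound_boundedOrbit (M : Submonoid E) :
    ∃ K : ℝ, 0 ≤ K ∧ ∀ w ∈ M, ∀ u ∈ boundedOrbit M, ‖w * u‖ ≤ K * ‖u‖ := by
  have : CompleteSpace (boundedOrbit M) := FiniteDimensional.complete ℝ _
  let g : M → (boundedOrbit M) →L[ℝ] E := fun w =>
    LinearMap.toContinuousLinearMap
      ((LinearMap.mulLeft ℝ (w : E)).comp (boundedOrbit M).subtype)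
  obtain ⟨K, hK⟩ := banach_steinhaus (g := g) (by
    rintro ⟨u, K, hK⟩
    exact ⟨K, fun w => hK w w.2⟩)
  refine ⟨max K 0, le_max_right _ _, fun w hw u hu => ?_⟩
  have h := (g ⟨w, hw⟩).le_opNorm ⟨u, hu⟩
  exact h.trans (mul_le_mul_of_nonneg_right ((hK _).trans (le_max_left _ _)) (norm_nonneg _))

/-- An unbounded orbit of a finitely generated monoid is unbounded already outside of the space of
bounded orbits. -/
theorem exists_large_of_notMem_boundedOrbit {Sig : Set E} (hfin : Sig.Finite) {y : E}
    (hy : y ∉ boundedOrbit (Submonoid.closure Sig)) (K : ℝ) :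
    ∃ w ∈ Submonoid.closure Sig,
      w * y ∉ boundedOrbit (Submonoid.closure Sig) ∧ K < ‖w * y‖ := by
  by_contra! hcon
  obtain ⟨L, hL0, hL⟩ := exists_uniform_bound_boundedOrbit (Submonoid.closure Sig)
  obtain ⟨a, ha⟩ := hfin.isBounded.exists_norm_le
  -- Just before an orbit enters the space of bounded orbits its norm is at most `K`; the entering
  -- letter costs a factor `a`, and everything afterwards a factor `L`.
  have key : ∀ w ∈ Submonoid.closure Sig, w * y ∉ boundedOrbit (Submonoid.closure Sig) ∨
      ∀ v ∈ Submonoid.closure Sig, ‖v * (w * y)‖ ≤ L * (a * K) := by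
    intro w hw
    induction hw using Submonoid.closure_induction_left with
    | one => left; simpa using hy
    | mul_left s hs w hw ih =>
      have hs' := Submonoid.subset_closure hs
      rcases ih with ih | ih
      · by_cases hU : s * w * y ∈ boundedOrbit (Submonoid.closure Sig)
        · right
          intro v hv
          refine (hL v hv _ hU).trans (mul_le_mul_of_nonneg_left ?_ hL0)
          rw [mul_assoc]
          exact (norm_mul_le _ _).trans (mul_le_mul (ha s hs) (hcon w hw ih) (norm_nonneg _)
            ((norm_nonneg _).trans (ha s hs)))
        · exact Or.inl hU
      · right
        intro v hv
        have := ih (v * s) (mul_mem hv hs')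
        simpa only [mul_assoc] using this
  refine hy ⟨max K (L * (a * K)), fun w hw => ?_⟩
  rcases key w hw with h | h
  · exact (hcon w hw h).trans (le_max_left _ _)
  · have := h 1 (one_mem _)
    rw [one_mul] at this
    exact this.trans (le_max_right _ _)

/-- A finite set all infinite left products of which converge is product bounded. -/
theorem exists_bound_of_leftProd_convergent {Sig : Set E} (hfin : Sig.Finite)
    (h : ∀ s : ℕ → E, (∀ i, s i ∈ Sig) → ∃ L, Tendsto (leftProd s) atTop (𝓝 L)) :
    ∃ K : ℝ, ∀ w ∈ Submonoid.closure Sig, ‖w‖ ≤ K := by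
  by_cases h1 : (1 : E) ∈ boundedOrbit (Submonoid.closure Sig)
  · obtain ⟨K, hK⟩ := h1
    exact ⟨K, fun w hw => by simpa using hK w hw⟩
  exfalso
  -- Words are stored with the rightmost factor first, so appending letters multiplies on the left.
  -- Staying outside the bounded orbits is what allows the next extension.
  let X := {l : List E // (∀ x ∈ l, x ∈ Sig) ∧
    l.reverse.prod ∉ boundedOrbit (Submonoid.closure Sig)}
  have step : ∀ (k : ℕ) (l : X), ∃ l' : X, (∃ t : List E, t ≠ [] ∧ l'.1 = l.1 ++ t) ∧
      (k : ℝ) < ‖l'.1.reverse.prod‖ := by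
    rintro k ⟨l, hl, hy⟩
    obtain ⟨w, hw, hwU, hwK⟩ :=
      -- Exceeding the current norm forces the appended word to be nonempty.
      exists_large_of_notMem_boundedOrbit hfin hy (max k ‖l.reverse.prod‖)
    obtain ⟨t, ht, rfl⟩ := Submonoid.exists_list_of_mem_closure hw
    have e : (l ++ t.reverse).reverse.prod = t.prod * l.reverse.prod := by simp
    refine ⟨⟨l ++ t.reverse, ?_, by rwa [e]⟩, ⟨t.reverse, ?_, rfl⟩, ?_⟩
    · intro x hx
      rcases List.mem_append.1 hx with hx | hx
      · exact hl x hx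
      · exact ht x (List.mem_reverse.1 hx)
    · rintro ht0
      rw [List.reverse_eq_nil_iff] at ht0
      subst ht0
      rw [List.prod_nil, one_mul] at hwK
      exact absurd ((le_max_right _ _).trans_lt hwK) (lt_irrefl _)
    · change (k : ℝ) < ‖(l ++ t.reverse).reverse.prod‖
      rw [e]
      exact (le_max_left _ _).trans_lt hwK
  choose f hf₁ hf₂ using step
  let l : ℕ → X := fun k => Nat.rec ⟨[], by simp, by simpa using h1⟩ (fun k x => f k x) k
  obtain ⟨s, hs⟩ := exists_seq_of_chain (fun k => (l k).1) (fun k => hf₁ k (l k))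
  have hsS : ∀ i, s i ∈ Sig := by
    intro i
    refine (l (i + 1)).2.1 _ ?_
    rw [(hs (i + 1)).2]
    exact List.mem_map_of_mem (List.mem_range.2 (hs (i + 1)).1)
  obtain ⟨L, hL⟩ := h s hsS
  have hlen : Tendsto (fun k => (l k).1.length) atTop atTop :=
    tendsto_atTop_mono (fun k => (hs k).1) tendsto_id
  have hlim := ((hL.comp hlen).norm).comp (tendsto_add_atTop_nat 1)
  have htop : Tendsto (fun k : ℕ => ‖leftProd s (l (k + 1)).1.length‖) atTop atTop := by
    refine tendsto_atTop_mono (fun k => ?_) tendsto_natCast_atTop_atTop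
    rw [leftProd_eq_of_range (hs (k + 1)).2]
    exact (hf₂ k (l k)).le
  exact not_tendsto_nhds_of_tendsto_atTop htop _ hlim

/-- Uniform convergence: long products of elements of `C` are close to the common limit. -/
theorem exists_length_prod_near {C : Set E} {K : ℝ}
    (hK : ∀ w ∈ Submonoid.closure C, ‖w‖ ≤ K) {P : E} (hP : ∀ c ∈ C, c * P = P)
    (hlim : ∀ c : ℕ → E, (∀ i, c i ∈ C) → Tendsto (leftProd c) atTop (𝓝 P))
    {ε : ℝ} (hε : 0 < ε) :
    ∃ N : ℕ, ∀ l : List E, (∀ c ∈ l, c ∈ C) → N ≤ l.length → ‖l.prod - P‖ < ε := by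
  by_contra! hcon
  have hK0 : 0 ≤ K := (norm_nonneg _).trans (hK 1 (one_mem _))
  have : ProperSpace E := FiniteDimensional.proper ℝ E
  have hPM : ∀ w ∈ Submonoid.closure C, w * P = P := by
    intro w hw
    induction hw using Submonoid.closure_induction_left with
    | one => rw [one_mul]
    | mul_left s hs w hw ih => rw [mul_assoc, ih, hP s hs]
  have hcomp : IsCompact (closure C) :=
    (isBounded_iff_forall_norm_le.2
      ⟨K, fun c hc => hK c (Submonoid.subset_closure hc)⟩).isCompact_closure
  set η := ε / (K + 1) with hη
  have hη0 : 0 < η := by positivity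
  have hcont : ∀ m, Continuous fun d : ℕ → E => leftProd d m := by
    intro m
    induction m with
    | zero => exact continuous_const
    | succ m ih =>
      simp only [leftProd_succ]
      exact (continuous_apply m).mul ih
  -- These sets are nested and, by Tychonoff, compact. A common point would be a sequence in
  -- `closure C` whose left products all stay away from `P`.
  let F : ℕ → Set (ℕ → E) := fun N =>
    (Set.univ.pi fun _ => closure C) ∩ {d | ∀ m ≤ N, η ≤ ‖leftProd d m - P‖}
  have hclosed : ∀ N, IsClosed {d : ℕ → E | ∀ m ≤ N, η ≤ ‖leftProd d m - P‖} := by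
    intro N
    simp only [Set.ofPred_forall]
    exact isClosed_iInter fun m => isClosed_iInter fun _ =>
      isClosed_le continuous_const ((hcont m).sub continuous_const).norm
  have hne : ∀ N, (F N).Nonempty := by
    intro N
    obtain ⟨l, hlC, hlen, hl⟩ := hcon (N + 1)
    -- The finite word is continued by repeating one of its own letters, which keeps the sequence in
    -- `C`; only its first `N` places matter.
    have hmem : ∀ i, l.reverse.getD i (l.headD 1) ∈ C := by
      intro i
      by_cases hi : i < l.reverse.length
      · rw [List.getD_eq_getElem _ _ hi]
        exact hlC _ (List.mem_reverse.1 (List.getElem_mem _))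
      · rw [List.getD_eq_default _ _ (not_lt.1 hi)]
        cases l with
        | nil => simp at hlen
        | cons a l => exact hlC _ (by simp)
    have hrange : ∀ m ≤ N + 1, ((l.reverse.take m) = (List.range m).map
        fun i => l.reverse.getD i (l.headD 1)) := by
      intro m hm
      refine List.ext_getElem (by simp; omega) fun i h₁ h₂ => ?_
      have : i < l.reverse.length := by
        rw [List.length_reverse]; simp at h₂; omega
      rw [List.getElem_take, List.getElem_map, List.getElem_range,
        List.getD_eq_getElem _ _ this]
    refine ⟨fun i => l.reverse.getD i (l.headD 1),
      fun i _ => subset_closure (hmem i), fun m hm => ?_⟩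
    have e : leftProd (fun i => l.reverse.getD i (l.headD 1)) m =
        (l.reverse.take m).reverse.prod := by
      rw [hrange m (by omega), leftProd, List.map_reverse]
    have e2 : l.prod = (l.reverse.drop m).reverse.prod * (l.reverse.take m).reverse.prod := by
      rw [← List.prod_append, ← List.reverse_append, List.take_append_drop, List.reverse_reverse]
    set w := (l.reverse.drop m).reverse.prod with hw
    have hwC : w ∈ Submonoid.closure C := by
      refine list_prod_mem fun x hx => Submonoid.subset_closure (hlC x ?_)
      exact List.mem_reverse.1 (List.mem_of_mem_drop (List.mem_reverse.1 hx))
    rw [e]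
    -- Since `w * P = P`, once a right-hand part of the word is near `P` the whole product stays
    -- near; so failure for `l` means failure for all its right-hand parts.
    have e3 : l.prod - P = w * ((l.reverse.take m).reverse.prod - P) := by
      rw [mul_sub, ← e2, hPM w hwC]
    rw [e3] at hl
    have h4 : ε ≤ (K + 1) * ‖(l.reverse.take m).reverse.prod - P‖ :=
      hl.trans ((norm_mul_le _ _).trans
        (mul_le_mul_of_nonneg_right ((hK w hwC).trans (by linarith)) (norm_nonneg _)))
    rw [hη, div_le_iff₀ (by linarith)]
    linarith
  obtain ⟨d, hd⟩ := IsCompact.nonempty_iInter_of_sequence_nonempty_isCompact_isClosed F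
    (fun N d hd => ⟨hd.1, fun m hm => hd.2 m (by omega)⟩) hne
    ((isCompact_univ_pi fun _ => hcomp).inter_right (hclosed 0))
    (fun N => (isClosed_set_pi fun _ _ => isClosed_closure).inter (hclosed N))
  rw [Set.mem_iInter] at hd
  obtain ⟨m, hm⟩ := exists_leftProd_near hK hlim (fun i => (hd 0).1 i trivial) hη0
  exact absurd hm (not_lt.2 ((hd m).2 m le_rfl))

end Algebra

/-! ### Complete words -/

/-- A word with letters in `V` in which every letter of `V` occurs. -/
def IsCompleteWord {E : Type*} (V : Set E) (l : List E) : Prop :=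
  (∀ x ∈ l, x ∈ V) ∧ ∀ x ∈ V, x ∈ l

section Algebra

variable {E : Type*} [NormedRing E]

/-- A convergent left product in which every element of `V` occurs infinitely often converges to
the projection onto the elements fixed by `V`. -/
theorem eq_of_tendsto_leftProd {V : Set E} {P L : E} (hPA : ∀ A ∈ V, P * A = P)
    (hfix : ∀ X, (∀ A ∈ V, A * X = X) → P * X = X) {s : ℕ → E} (hs : ∀ i, s i ∈ V)
    (hfreq : ∀ A ∈ V, ∃ᶠ m in atTop, s m = A) (hL : Tendsto (leftProd s) atTop (𝓝 L)) :
    L = P := by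
  have h1 : P * L = L := by
    refine hfix L fun A hA => ?_
    -- This difference vanishes whenever `s m = A`, hence infinitely often, so its limit is zero.
    have hlim : Tendsto (fun m => A * leftProd s m - leftProd s (m + 1)) atTop (𝓝 (A * L - L)) :=
      (hL.const_mul A).sub (hL.comp (tendsto_add_atTop_nat 1))
    have := isClosed_singleton.mem_of_frequently_of_tendsto (s := {(0 : E)})
      ((hfreq A hA).mono fun m hm => by rw [leftProd_succ, hm]; simp) hlim
    exact sub_eq_zero.1 this
  have h2 : ∀ m, P * leftProd s m = P := by
    intro m
    induction m with
    | zero => simp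
    | succ m ih => rw [leftProd_succ, ← mul_assoc, hPA _ (hs m), ih]
  have h3 := hL.const_mul P
  simp only [h2] at h3
  rw [← h1]
  exact (tendsto_nhds_unique h3 tendsto_const_nhds)

/-- Spelling out the words gives one sequence of letters in which every element of `V` recurs; the
products of words form a subsequence of its left products. -/
theorem tendsto_leftProd_of_complete {V : Set E} (hne : V.Nonempty)
    (h : ∀ s : ℕ → E, (∀ i, s i ∈ V) → ∃ L, Tendsto (leftProd s) atTop (𝓝 L))
    {P : E} (hPA : ∀ A ∈ V, P * A = P)
    (hfix : ∀ X, (∀ A ∈ V, A * X = X) → P * X = X) (t : ℕ → List E)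
    (ht : ∀ i, IsCompleteWord V (t i)) :
    Tendsto (leftProd fun i => (t i).prod) atTop (𝓝 P) := by
  let l : ℕ → List E := fun k => Nat.rec [] (fun k x => x ++ (t k).reverse) k
  have hl : ∀ k, l (k + 1) = l k ++ (t k).reverse := fun k => rfl
  obtain ⟨s, hs⟩ := exists_seq_of_chain l fun k => ⟨(t k).reverse, by
    obtain ⟨x, hx⟩ := hne
    have := (ht k).2 x hx
    rw [Ne, List.reverse_eq_nil_iff]
    exact List.ne_nil_of_mem this, hl k⟩
  have hlV : ∀ k, ∀ x ∈ l k, x ∈ V := by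
    intro k
    induction k with
    | zero => intro x hx; exact absurd hx List.not_mem_nil
    | succ k ih =>
      intro x hx
      rw [hl, List.mem_append, List.mem_reverse] at hx
      exact hx.elim (ih x) ((ht k).1 x)
  have hsV : ∀ i, s i ∈ V := by
    intro i
    refine hlV (i + 1) _ ?_
    rw [(hs (i + 1)).2]
    exact List.mem_map_of_mem (List.mem_range.2 (hs (i + 1)).1)
  have hfreq : ∀ A ∈ V, ∃ᶠ m in atTop, s m = A := by
    intro A hA
    rw [frequently_atTop]
    intro k
    obtain ⟨j, hj, e⟩ := List.getElem_of_mem (List.mem_reverse.2 ((ht k).2 A hA))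
    have hj' : (l k).length + j < (l (k + 1)).length := by
      rw [hl, List.length_append]; omega
    refine ⟨(l k).length + j, (hs k).1.trans (Nat.le_add_right _ _), ?_⟩
    have h1 : (l (k + 1))[(l k).length + j] = A := by
      simp only [hl, List.getElem_append_right (Nat.le_add_right _ _)]
      simpa using e
    have h2 : (l (k + 1))[(l k).length + j]? =
        ((List.range (l (k + 1)).length).map s)[(l k).length + j]? := by
      rw [← (hs (k + 1)).2]
    rw [List.getElem?_eq_getElem hj', h1, List.getElem?_map, List.getElem?_range hj'] at h2
    simpa using h2.symm
  obtain ⟨L, hL⟩ := h s hsV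
  obtain rfl := eq_of_tendsto_leftProd hPA hfix hsV hfreq hL
  have hprod : ∀ k, leftProd (fun i => (t i).prod) k = leftProd s (l k).length := by
    intro k
    rw [leftProd_eq_of_range (hs k).2]
    induction k with
    | zero => rfl
    | succ k ih => rw [leftProd_succ, ih, hl, List.reverse_append, List.reverse_reverse,
        List.prod_append]
  refine Tendsto.congr (fun k => (hprod k).symm) (hL.comp ?_)
  exact tendsto_atTop_mono (fun k => (hs k).1) tendsto_id

/-- Products of many complete words are close to the projection. -/
theorem exists_length_flatten_near [NormedAlgebra ℝ E] [FiniteDimensional ℝ E] {V : Set E}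
    (hfin : V.Finite) (hne : V.Nonempty)
    (h : ∀ s : ℕ → E, (∀ i, s i ∈ V) → ∃ L, Tendsto (leftProd s) atTop (𝓝 L))
    {P : E} (hAP : ∀ A ∈ V, A * P = P) (hPA : ∀ A ∈ V, P * A = P)
    (hfix : ∀ X, (∀ A ∈ V, A * X = X) → P * X = X) {ε : ℝ} (hε : 0 < ε) :
    ∃ N : ℕ, ∀ ls : List (List E), (∀ l ∈ ls, IsCompleteWord V l) → N ≤ ls.length →
      ‖ls.flatten.prod - P‖ < ε := by
  obtain ⟨K, hK⟩ := exists_bound_of_leftProd_convergent hfin h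
  -- Complete words are treated as single letters. `C` may be infinite, but it generates a submonoid
  -- of the one generated by `V`, so the same `K` serves.
  let C : Set E := {w | ∃ l, IsCompleteWord V l ∧ l.prod = w}
  have hCV : C ⊆ Submonoid.closure V := by
    rintro _ ⟨l, hl, rfl⟩
    exact list_prod_mem fun x hx => Submonoid.subset_closure (hl.1 x hx)
  have hVP : ∀ w ∈ Submonoid.closure V, w * P = P := by
    intro w hw
    induction hw using Submonoid.closure_induction_left with
    | one => rw [one_mul]
    | mul_left s hs w hw ih => rw [mul_assoc, ih, hAP s hs]
  obtain ⟨N, hN⟩ := exists_length_prod_near (C := C)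
    (fun w hw => hK w (Submonoid.closure_le.2 hCV hw)) (fun c hc => hVP c (hCV hc)) (by
      intro c hc
      choose t ht e using hc
      have := tendsto_leftProd_of_complete hne h hPA hfix t ht
      simpa only [e] using this) hε
  refine ⟨N, fun ls hls hlen => ?_⟩
  rw [List.prod_flatten]
  refine hN _ (fun c hc => ?_) (by simpa using hlen)
  obtain ⟨l, hl, rfl⟩ := List.mem_map.1 hc
  exact ⟨l, hls l hl, rfl⟩

end Algebra

/-! ### Algebra of the projection onto the fixed space -/

section Projection

variable {n : ℕ} {T : Set (Mat n)} {P : Mat n}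

theorem mem_fixedSpace {x : Fin n → ℝ} : x ∈ fixedSpace T ↔ ∀ A ∈ T, A.mulVec x = x := by
  simp only [fixedSpace, Submodule.mem_iInf, LinearMap.mem_ker, Matrix.toLin'_apply,
    Matrix.sub_mulVec, Matrix.one_mulVec, sub_eq_zero]
  exact forall₂_congr fun _ _ => eq_comm

theorem sub_mulVec_mem_rangeSpace {A : Mat n} (hA : A ∈ T) (x : Fin n → ℝ) :
    x - A.mulVec x ∈ rangeSpace T := by
  refine Submodule.mem_iSup_of_mem A (Submodule.mem_iSup_of_mem hA ⟨x, ?_⟩)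
  simp

theorem eq_zero_of_mem_fixedSpace_of_mem_rangeSpace (hT : IsCompl (fixedSpace T) (rangeSpace T))
    {x : Fin n → ℝ} (h1 : x ∈ fixedSpace T) (h2 : x ∈ rangeSpace T) : x = 0 :=
  Submodule.disjoint_def.1 hT.disjoint x h1 h2

theorem exists_isProjection (hT : IsCompl (fixedSpace T) (rangeSpace T)) :
    ∃ P : Mat n, IsProjection T P := by
  set p := Submodule.projectionOnto _ _ hT with hp
  refine ⟨LinearMap.toMatrix' ((fixedSpace T).subtype.comp p), fun x => ?_⟩
  rw [LinearMap.toMatrix'_mulVec]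
  refine ⟨(p x).2, ?_⟩
  have : x - p x ∈ LinearMap.ker p := by
    rw [LinearMap.mem_ker, map_sub, hp, Submodule.projectionOnto_apply_left, sub_self]
  rwa [hp, Submodule.ker_projectionOnto] at this

theorem IsProjection.mul_left (hP : IsProjection T P) {A : Mat n} (hA : A ∈ T) : A * P = P := by
  refine Matrix.ext_of_mulVec_single fun i => ?_
  rw [← Matrix.mulVec_mulVec]
  exact mem_fixedSpace.1 (hP _).1 A hA

theorem IsProjection.mulVec_eq_zero (hP : IsProjection T P)
    (hT : IsCompl (fixedSpace T) (rangeSpace T)) {x : Fin n → ℝ} (hx : x ∈ rangeSpace T) :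
    P.mulVec x = 0 := by
  refine eq_zero_of_mem_fixedSpace_of_mem_rangeSpace hT (hP x).1 ?_
  have := Submodule.sub_mem _ hx (hP x).2
  rwa [sub_sub_cancel] at this

theorem IsProjection.mul_right (hP : IsProjection T P)
    (hT : IsCompl (fixedSpace T) (rangeSpace T)) {A : Mat n} (hA : A ∈ T) : P * A = P := by
  refine Matrix.ext_of_mulVec_single fun i => ?_
  have := hP.mulVec_eq_zero hT (sub_mulVec_mem_rangeSpace hA (Pi.single i 1))
  rw [Matrix.mulVec_sub, sub_eq_zero] at this
  rw [← Matrix.mulVec_mulVec, ← this]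

theorem IsProjection.mul_eq_of_fixed (hP : IsProjection T P)
    (hT : IsCompl (fixedSpace T) (rangeSpace T)) {X : Mat n} (hX : ∀ A ∈ T, A * X = X) :
    P * X = X := by
  refine Matrix.ext_of_mulVec_single fun i => ?_
  set x := X.mulVec (Pi.single i 1) with hx
  have h : x ∈ fixedSpace T := mem_fixedSpace.2 fun A hA => by
    rw [hx, Matrix.mulVec_mulVec, hX A hA]
  rw [← Matrix.mulVec_mulVec, ← hx]
  exact (sub_eq_zero.1 (eq_zero_of_mem_fixedSpace_of_mem_rangeSpace hT
    (Submodule.sub_mem _ h (hP x).1) (hP x).2)).symm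

end Projection

section Convergence

attribute [local instance] Matrix.linftyOpNormedRing Matrix.linftyOpNormedAlgebra

/-- In a finite CP set, products of many complete words lie in a given neighbourhood of the
projection. -/
theorem IsCP.exists_length_flatten_mem {n : ℕ} {Sig V : Set (Mat n)} (hCP : IsCP Sig)
    (hfin : Sig.Finite) (hV : V ⊆ Sig) (hne : V.Nonempty) {P : Mat n} (hP : IsProjection V P)
    {U : Set (Mat n)} (hU : U ∈ 𝓝 P) :
    ∃ N : ℕ, ∀ ls : List (List (Mat n)), (∀ l ∈ ls, IsCompleteWord V l) → N ≤ ls.length →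
      ls.flatten.prod ∈ U := by
  have hT := hCP.transversal V hV
  obtain ⟨ε, hε, hball⟩ := Metric.mem_nhds_iff.1 hU
  obtain ⟨N, hN⟩ := exists_length_flatten_near (hfin.subset hV) hne
    (fun s hs => hCP.lcp s fun i => hV (hs i)) (fun A hA => hP.mul_left hA)
    (fun A hA => hP.mul_right hT hA) (fun X hX => hP.mul_eq_of_fixed hT hX) hε
  refine ⟨N, fun ls hls hlen => hball ?_⟩
  rw [Metric.mem_ball, dist_eq_norm]
  exact hN ls hls hlen

end Convergence

/-! ### Cutting an ordered set into blocks -/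

theorem exists_finset_image_eq {R α : Type*} {A : R → α} {V : Set α} {S : Set R}
    (hV : V.Finite) (h : V ⊆ A '' S) :
    ∃ G : Finset R, ↑G ⊆ S ∧ A '' G = V := by
  classical
  lift V to Finset α using hV
  obtain ⟨G, hG, e⟩ := Finset.subset_set_image_iff.1 h
  exact ⟨G, hG, by rw [← e, Finset.coe_image]⟩

section Blocks

variable {R α : Type*} [LinearOrder R] {A : R → α} {V : Set α} {S S' : Set R} {k : ℕ}

/-- `S` starts with `k` consecutive pieces, each of them with a last element, on which `A` takes
all values in `V`. -/
def HasBlocks (A : R → α) (V : Set α) : ℕ → Set R → Prop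
  | 0, _ => True
  | k + 1, S => ∃ m ∈ S, V ⊆ A '' (S ∩ Set.Iic m) ∧ HasBlocks A V k (S ∩ Set.Ioi m)

theorem HasBlocks.mono (h : HasBlocks A V k S) (hS : S ⊆ S') : HasBlocks A V k S' := by
  induction k generalizing S S' with
  | zero => trivial
  | succ k ih =>
    obtain ⟨m, hm, hV, hk⟩ := h
    exact ⟨m, hS hm, hV.trans (Set.image_mono (Set.inter_subset_inter_left _ hS)),
      ih hk (Set.inter_subset_inter_left _ hS)⟩

theorem HasBlocks.exists_finset (hV : V.Finite) (h : HasBlocks A V k S) :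
    ∃ G : Finset R, ↑G ⊆ S ∧ HasBlocks A V k (G : Set R) := by
  classical
  induction k generalizing S with
  | zero => exact ⟨∅, by simp, trivial⟩
  | succ k ih =>
    obtain ⟨m, hm, hVS, hk⟩ := h
    obtain ⟨G, hG, hGV⟩ := exists_finset_image_eq hV hVS
    obtain ⟨G', hG', hk'⟩ := ih hk
    refine ⟨insert m (G ∪ G'), ?_, m, by simp, ?_, hk'.mono ?_⟩
    · intro x hx
      simp only [Finset.coe_insert, Finset.coe_union, Set.mem_insert_iff, Set.mem_union] at hx
      rcases hx with rfl | hx | hx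
      · exact hm
      · exact (hG hx).1
      · exact (hG' hx).1
    · rw [← hGV]
      exact Set.image_mono fun x hx => ⟨by simp [Finset.mem_coe.1 hx], (hG hx).2⟩
    · exact fun x hx => ⟨by simp [Finset.mem_coe.1 hx], (hG' hx).2⟩

/-- The set with the smallest maximum `m` supplies the first block: any other set reaching down to
`m` would have `m` between two of its points, which `hsep` excludes. -/
theorem hasBlocks_biUnion {ι : Type*} (g : ι → Finset R) (I : Finset ι)
    (hne : ∀ i ∈ I, (g i).Nonempty) (hV : ∀ i ∈ I, V ⊆ A '' (g i))
    (hsep : ∀ i ∈ I, ∀ j ∈ I, i ≠ j → ∀ a ∈ g i, ∀ b ∈ g j, ∀ c ∈ g j, b ≤ a → ¬ a ≤ c) :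
    HasBlocks A V I.card (⋃ i ∈ I, (g i : Set R)) := by
  classical
  induction hk : I.card generalizing I with
  | zero => trivial
  | succ k ih =>
    obtain ⟨i, hi, hmin⟩ := Finset.exists_min_image I (fun i => (g i).max)
      (Finset.card_pos.1 (by omega))
    obtain ⟨m, hm⟩ := Finset.max_of_nonempty (hne i hi)
    have hmi := Finset.mem_of_max hm
    refine ⟨m, Set.mem_biUnion hi hmi, ?_, ?_⟩
    · refine (hV i hi).trans (Set.image_mono fun x hx => ⟨Set.mem_biUnion hi hx, ?_⟩)
      exact Finset.le_max_of_eq hx hm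
    · refine (ih (I.erase i) (fun j hj => hne j (Finset.mem_of_mem_erase hj))
        (fun j hj => hV j (Finset.mem_of_mem_erase hj))
        (fun j hj l hl => hsep j (Finset.mem_of_mem_erase hj) l (Finset.mem_of_mem_erase hl))
        (by rw [Finset.card_erase_of_mem hi, hk]; rfl)).mono ?_
      intro x hx
      obtain ⟨j, hj, hx⟩ := Set.mem_iUnion₂.1 hx
      have hjI := Finset.mem_of_mem_erase hj
      refine ⟨Set.mem_biUnion hjI hx, not_le.1 fun hxm => ?_⟩
      obtain ⟨b, hb⟩ := Finset.max_of_nonempty (hne j hjI)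
      have hmb : m ≤ b := by
        have := hmin j hjI
        rw [hm, hb] at this
        exact WithBot.coe_le_coe.1 this
      exact hsep i hi j hjI (Finset.ne_of_mem_erase hj).symm m hmi x hx b
        (Finset.mem_of_max hb) hxm hmb

/-- `S` is the union of finitely many consecutive pieces, on none of which `A` takes all values
in `V`. -/
def HasIncompletePartition (A : R → α) (V : Set α) (S : Set R) : Prop :=
  ∃ (m : ℕ) (T : Fin m → Set R), (⋃ i, T i) = S ∧
    (∀ i j, i < j → ∀ a ∈ T i, ∀ b ∈ T j, a < b) ∧ ∀ i, ¬ V ⊆ A '' (T i)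

theorem hasIncompletePartition_empty : HasIncompletePartition A V ∅ :=
  ⟨0, Fin.elim0, by simp, fun i => i.elim0, fun i => i.elim0⟩

theorem HasIncompletePartition.union (hS : ¬ V ⊆ A '' S) (h : HasIncompletePartition A V S')
    (hlt : ∀ a ∈ S, ∀ b ∈ S', a < b) : HasIncompletePartition A V (S ∪ S') := by
  obtain ⟨m, T, rfl, hT, hinc⟩ := h
  refine ⟨m + 1, Fin.cons S T, ?_, ?_, ?_⟩
  · ext x
    simp
  · intro i j hij a ha b hb
    cases j using Fin.cases with
    | zero => exact absurd hij (Fin.not_lt_zero i)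
    | succ j =>
      cases i using Fin.cases with
      | zero => exact hlt a ha b (Set.mem_iUnion_of_mem j hb)
      | succ i => exact hT i j (Fin.succ_lt_succ_iff.1 hij) a ha b hb
  · intro i
    cases i using Fin.cases with
    | zero => exact hS
    | succ i => exact hinc i

/-- Greedy cutting: `I` is the part before all values of `V` have appeared, and `J` is the rest.
Beyond any point of `J` one block fewer fits, so induction applies above it. Assumption `h1` lets a
least point of `J` form a piece by itself. -/
theorem hasIncompletePartition_of_not_hasBlocks (hV : V.Finite) (hne : V.Nonempty)
    (h1 : ∀ r, ¬ V ⊆ {A r})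
    (h : ¬ HasBlocks A V k S) : HasIncompletePartition A V S := by
  induction k generalizing S with
  | zero => exact absurd trivial h
  | succ k ih =>
    set I : Set R := {s ∈ S | ¬ V ⊆ A '' (S ∩ Set.Iic s)} with hI
    set J : Set R := {s ∈ S | V ⊆ A '' (S ∩ Set.Iic s)} with hJ
    have hIJ : I ∪ J = S := by
      ext x
      simp only [hI, hJ, Set.mem_union, Set.mem_ofPred_eq]
      tauto
    have hlt : ∀ a ∈ I, ∀ b ∈ J, a < b := by
      rintro a ⟨-, ha⟩ b ⟨-, hb⟩
      refine not_le.1 fun hba => ha (hb.trans (Set.image_mono ?_))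
      exact Set.inter_subset_inter_right _ (Set.Iic_subset_Iic.2 hba)
    -- Finitely many points would witness all of `V`, and their maximum could not belong to `I`.
    have hIinc : ¬ V ⊆ A '' I := by
      intro hVI
      obtain ⟨G, hG, hGV⟩ := exists_finset_image_eq hV hVI
      rcases G.eq_empty_or_nonempty with rfl | hGne
      · rw [Finset.coe_empty, Set.image_empty] at hGV
        exact hne.ne_empty hGV.symm
      · refine (hG (G.max'_mem hGne)).2 ?_
        rw [← hGV]
        exact Set.image_mono fun x hx => ⟨(hG hx).1, G.le_max' x hx⟩
    rw [← hIJ]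
    refine HasIncompletePartition.union hIinc ?_ hlt
    have hnb : ∀ m ∈ J, ¬ HasBlocks A V k (S ∩ Set.Ioi m) := fun m hm hk =>
      h ⟨m, hm.1, hm.2, hk⟩
    rcases J.eq_empty_or_nonempty with hJe | ⟨j₀, hj₀⟩
    · rw [hJe]; exact hasIncompletePartition_empty
    by_cases hleast : ∃ m, IsLeast J m
    · obtain ⟨m, hm, hmin⟩ := hleast
      have e : J = {m} ∪ (S ∩ Set.Ioi m) := by
        ext x
        constructor
        · intro hx
          rcases (hmin hx).eq_or_lt with rfl | hlt
          · exact Or.inl rfl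
          · exact Or.inr ⟨hx.1, hlt⟩
        · rintro (rfl | ⟨hx, hlt⟩)
          · exact hm
          · exact ⟨hx, hm.2.trans (Set.image_mono (Set.inter_subset_inter_right _
              (Set.Iic_subset_Iic.2 (le_of_lt hlt))))⟩
      rw [e]
      refine HasIncompletePartition.union ?_ (ih (hnb m hm)) ?_
      · rw [Set.image_singleton]; exact h1 m
      · rintro a rfl b hb
        exact hb.2
    -- Without a least point, the finitely many points witnessing `k` blocks of `J` all lie above
    -- some further `m ∈ J`, which would complete `k + 1` blocks.
    · refine ih fun hk => ?_
      obtain ⟨G, hG, hk⟩ := hk.exists_finset hV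
      have hlow : ∃ m ∈ J, ∀ x ∈ G, m < x := by
        rcases G.eq_empty_or_nonempty with rfl | hne
        · exact ⟨j₀, hj₀, by simp⟩
        · have hmin : ¬ IsLeast J (G.min' hne) := fun hl => hleast ⟨_, hl⟩
          have : ∃ m ∈ J, m < G.min' hne := by
            by_contra! hcon
            exact hmin ⟨hG (G.min'_mem hne), hcon⟩
          obtain ⟨m, hm, hlt⟩ := this
          exact ⟨m, hm, fun x hx => hlt.trans_le (G.min'_le x hx)⟩
      obtain ⟨m, hm, hlt⟩ := hlow
      exact hnb m hm (hk.mono fun x hx => ⟨(hG hx).1, hlt x hx⟩)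

end Blocks

/-! ### Complete intervals versus blocks -/

section CompleteIntervals

variable {n : ℕ} {R : Type*} [LinearOrder R] {A : R → Mat n} {S : Set R} {k : ℕ}

theorem HasCompleteIntervals.exists_finset_hasBlocks (hfin : (A '' S).Finite)
    (h : HasCompleteIntervals A S k) :
    ∃ G : Finset R, ↑G ⊆ S ∧ HasBlocks A (A '' S) k (G : Set R) := by
  classical
  obtain ⟨T, hint, hne, hdisj, himg⟩ := h
  choose g hgT hgV using fun i => exists_finset_image_eq hfin (himg i).ge
  refine ⟨Finset.univ.biUnion g, ?_, ?_⟩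
  · intro x hx
    obtain ⟨i, -, hx⟩ := Finset.mem_biUnion.1 hx
    exact (hint i).1 (hgT i hx)
  · have := hasBlocks_biUnion (A := A) (V := A '' S) g Finset.univ (fun i _ => ?_)
      (fun i _ => (hgV i).ge) ?_
    · rw [Finset.card_univ, Fintype.card_fin] at this
      exact this.mono (by simp)
    · have : (A '' (g i : Set R)).Nonempty := by
        rw [hgV, ← himg i]
        exact (hne i).image A
      exact Finset.coe_nonempty.1 this.of_image
    · intro i _ j _ hij a ha b hb c hc hba hac
      have haj : a ∉ T j := Set.disjoint_left.1 (hdisj i j hij) (hgT i ha)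
      refine haj ((hint j).2 b (hgT j hb) c (hgT j hc) a ((hint i).1 (hgT i ha))
        (lt_of_le_of_ne hba ?_) (lt_of_le_of_ne hac ?_))
      · rintro rfl; exact haj (hgT j hb)
      · rintro rfl; exact haj (hgT j hc)

theorem HasBlocks.exists_intervals {V : Set (Mat n)} (h : HasBlocks A V k S) :
    ∃ T : Fin k → Set R, (∀ i, IsInterval S (T i)) ∧ (∀ i j, i ≠ j → Disjoint (T i) (T j)) ∧
      ∀ i, V ⊆ A '' (T i) := by
  induction k generalizing S with
  | zero => exact ⟨Fin.elim0, fun i => i.elim0, fun i => i.elim0, fun i => i.elim0⟩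
  | succ k ih =>
    obtain ⟨m, hm, hV, hk⟩ := h
    obtain ⟨T, hint, hdisj, hTV⟩ := ih hk
    have hT0 : ∀ i, Disjoint (S ∩ Set.Iic m) (T i) := fun i =>
      Set.disjoint_left.2 fun x hx hxi => absurd ((hint i).1 hxi).2 (not_lt.2 hx.2)
    refine ⟨Fin.cons (S ∩ Set.Iic m) T, ?_, ?_, ?_⟩
    · intro i
      cases i using Fin.cases with
      | zero =>
        exact ⟨Set.inter_subset_left, fun a _ b hb g hg _ hgb => ⟨hg, hgb.le.trans hb.2⟩⟩
      | succ i =>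
        refine ⟨fun x hx => ((hint i).1 hx).1, fun a ha b hb g hg hag hgb => ?_⟩
        exact (hint i).2 a ha b hb g ⟨hg, lt_trans ((hint i).1 ha).2 hag⟩ hag hgb
    · intro i j hij
      cases i using Fin.cases with
      | zero =>
        cases j using Fin.cases with
        | zero => exact absurd rfl hij
        | succ j => exact hT0 j
      | succ i =>
        cases j using Fin.cases with
        | zero => exact (hT0 i).symm
        | succ j => exact hdisj i j fun e => hij (e ▸ rfl)
    · intro i
      cases i using Fin.cases with
      | zero => exact hV
      | succ i => exact hTV i

theorem HasBlocks.hasCompleteIntervals (hne : S.Nonempty) (h : HasBlocks A (A '' S) k S) :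
    HasCompleteIntervals A S k := by
  obtain ⟨T, hint, hdisj, hTV⟩ := h.exists_intervals
  exact ⟨T, hint, fun i => ((hne.image A).mono (hTV i)).of_image, hdisj,
    fun i => (Set.image_mono (hint i).1).antisymm (hTV i)⟩

theorem completeIndex_eq_top_iff :
    completeIndex A S = ⊤ ↔ ∀ N, ∃ m, N ≤ m ∧ HasCompleteIntervals A S m := by
  constructor
  · intro h N
    by_contra! hcon
    have hle : completeIndex A S ≤ N := iSup₂_le fun m hm => by
      rcases le_total N m with hNm | hmN
      · exact absurd hm (hcon m hNm)
      · exact_mod_cast hmN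
    rw [h] at hle
    exact ENat.natCast_ne_top N (top_le_iff.1 hle)
  · intro h
    refine ENat.eq_top_iff_forall_ge.2 fun N => ?_
    obtain ⟨m, hNm, hm⟩ := h N
    exact le_trans (by exact_mod_cast hNm) (le_iSup₂ (f := fun (m : ℕ) _ => (m : ℕ∞)) m hm)

/-- Every point is a complete interval. This keeps infinite sets with a single value out of the
partition case, where singletons must be incomplete. -/
theorem completeIndex_eq_top_of_image_subset_singleton (hS : S.Infinite) {a : Mat n}
    (h : A '' S ⊆ {a}) : completeIndex A S = ⊤ := by
  refine completeIndex_eq_top_iff.2 fun N => ⟨N, le_rfl, ?_⟩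
  have f := hS.natEmbedding
  have hval : ∀ s ∈ S, A s = a := fun s hs => h ⟨s, hs, rfl⟩
  have hne : S.Nonempty := hS.nonempty
  refine ⟨fun i => {(f i : R)}, fun i => ⟨Set.singleton_subset_iff.2 (f i).2, ?_⟩,
    fun i => Set.singleton_nonempty _, fun i j hij => ?_, fun i => ?_⟩
  · rintro x rfl y rfl g - h1 h2
    exact absurd (h1.trans h2) (lt_irrefl _)
  · rw [Set.disjoint_singleton]
    intro e
    exact hij (Fin.ext (f.injective (Subtype.ext e)))
  · rw [Set.image_singleton, hval _ (f i).2]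
    refine (h.antisymm ?_).symm
    obtain ⟨s, hs⟩ := hne
    exact Set.singleton_subset_iff.2 ⟨s, hs, hval s hs⟩

end CompleteIntervals

/-! ### The iterative product as a limit of finite products -/

section ContProd

variable {n : ℕ} {R : Type*} [LinearOrder R] {A : R → Mat n} {S S' : Set R} {X X' : Mat n}

@[simp] theorem finProd_empty : finProd A ∅ = 1 := by simp [finProd]

@[simp] theorem finProd_singleton (r : R) : finProd A {r} = A r := by simp [finProd]

theorem sort_union {G H : Finset R} (h : ∀ a ∈ G, ∀ b ∈ H, a < b) :
    (G ∪ H).sort (· ≤ ·) = G.sort (· ≤ ·) ++ H.sort (· ≤ ·) := by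
  refine (Finset.sortedLT_sort _).eq_of_mem_iff ?_ (by simp)
  rw [List.sortedLT_iff_pairwise, List.pairwise_append]
  refine ⟨(Finset.sortedLT_sort _).pairwise, (Finset.sortedLT_sort _).pairwise, ?_⟩
  simpa using h

theorem finProd_union {G H : Finset R} (h : ∀ a ∈ G, ∀ b ∈ H, a < b) :
    finProd A (G ∪ H) = finProd A G * finProd A H := by
  rw [finProd, sort_union h, List.map_append, List.prod_append, finProd, finProd]

theorem finProd_subtype (G : Finset S) :
    finProd (fun r : S => A r) G = finProd A (G.map (Function.Embedding.subtype _)) := by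
  rw [finProd, finProd, ← Finset.map_sort (r := (· ≤ ·)) (r' := (· ≤ ·)), List.map_map]
  · rfl
  · intro a _ b _; rfl

theorem hasLimitProd_iff : HasLimitProd A S X ↔ ∀ U ∈ 𝓝 X, ∃ G₀ : Finset R, ↑G₀ ⊆ S ∧
    ∀ G : Finset R, G₀ ⊆ G → ↑G ⊆ S → finProd A G ∈ U := by
  classical
  have key : ∀ G : Finset R, ↑G ⊆ S → (G.subtype (· ∈ S)).map (Function.Embedding.subtype _) = G :=
    fun G hG => Finset.subtype_map_of_mem hG
  rw [HasLimitProd, tendsto_def]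
  refine forall₂_congr fun U _ => ?_
  rw [mem_atTop_sets]
  constructor
  · rintro ⟨G₀, h⟩
    refine ⟨G₀.map (Function.Embedding.subtype _), by simp, fun G hG₀ hG => ?_⟩
    have := h (G.subtype (· ∈ S)) (by
      rw [← key G hG] at hG₀
      exact Finset.map_subset_map.1 hG₀)
    rwa [Set.mem_preimage, finProd_subtype, key G hG] at this
  · rintro ⟨G₀, hG₀, h⟩
    refine ⟨G₀.subtype (· ∈ S), fun G hG => ?_⟩
    rw [Set.mem_preimage, finProd_subtype]
    refine h _ ?_ (by simp)
    rw [← key G₀ hG₀]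
    exact Finset.map_subset_map.2 hG

theorem HasLimitProd.unique (h : HasLimitProd A S X) (h' : HasLimitProd A S X') : X = X' :=
  tendsto_nhds_unique h h'

theorem hasLimitProd_finite (G : Finset R) : HasLimitProd A (G : Set R) (finProd A G) := by
  refine hasLimitProd_iff.2 fun U hU => ⟨G, subset_rfl, fun H h1 h2 => ?_⟩
  rw [(Finset.coe_subset.1 h2).antisymm h1]
  exact mem_of_mem_nhds hU

theorem HasLimitProd.union (h : HasLimitProd A S X) (h' : HasLimitProd A S' X')
    (hlt : ∀ a ∈ S, ∀ b ∈ S', a < b) : HasLimitProd A (S ∪ S') (X * X') := by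
  classical
  refine hasLimitProd_iff.2 fun U hU => ?_
  have hmul : Tendsto (fun p : Mat n × Mat n => p.1 * p.2) (𝓝 (X, X')) (𝓝 (X * X')) :=
    continuous_mul.tendsto (X, X')
  obtain ⟨V, hV, V', hV', hVV'⟩ := mem_nhds_prod_iff.1 (hmul hU)
  obtain ⟨G₁, hG₁, h₁⟩ := hasLimitProd_iff.1 h V hV
  obtain ⟨G₂, hG₂, h₂⟩ := hasLimitProd_iff.1 h' V' hV'
  refine ⟨G₁ ∪ G₂, ?_, fun G hG hGS => ?_⟩
  · rw [Finset.coe_union]; exact Set.union_subset_union hG₁ hG₂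
  · have e : G = G.filter (· ∈ S) ∪ G.filter (· ∈ S') := by
      ext x
      simp only [Finset.mem_union, Finset.mem_filter]
      have : x ∈ G → x ∈ S ∨ x ∈ S' := fun hx => hGS hx
      tauto
    rw [e, finProd_union (by simp only [Finset.mem_filter]; exact fun a ha b hb => hlt a ha.2 b hb.2)]
    refine hVV' (Set.mk_mem_prod (h₁ _ ?_ ?_) (h₂ _ ?_ ?_))
    · exact fun x hx => Finset.mem_filter.2 ⟨hG (Finset.mem_union_left _ hx), hG₁ hx⟩
    · exact fun x hx => (Finset.mem_filter.1 hx).2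
    · exact fun x hx => Finset.mem_filter.2 ⟨hG (Finset.mem_union_right _ hx), hG₂ hx⟩
    · exact fun x hx => (Finset.mem_filter.1 hx).2

theorem hasLimitProd_iUnion {m : ℕ} (T : Fin m → Set R) (X : Fin m → Mat n)
    (hlt : ∀ i j, i < j → ∀ a ∈ T i, ∀ b ∈ T j, a < b)
    (h : ∀ i, HasLimitProd A (T i) (X i)) : HasLimitProd A (⋃ i, T i) (List.ofFn X).prod := by
  induction m with
  | zero => simpa using hasLimitProd_finite (A := A) ∅
  | succ m ih =>
    have e : (⋃ i, T i) = T 0 ∪ ⋃ i : Fin m, T i.succ := by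
      ext x; simp [Fin.exists_fin_succ]
    rw [e, List.ofFn_succ, List.prod_cons]
    refine (h 0).union (ih _ _ (fun i j hij => hlt _ _ (Fin.succ_lt_succ_iff.2 hij))
      fun i => h i.succ) fun a ha b hb => ?_
    obtain ⟨i, hi⟩ := Set.mem_iUnion.1 hb
    exact hlt 0 i.succ (Fin.succ_pos i) a ha b hi

/-- The word of a finite set with `k + 1` blocks is a product of `k + 1` complete words. -/
theorem HasBlocks.exists_flatten {V : Set (Mat n)} {k : ℕ} {G : Finset R}
    (h : HasBlocks A V (k + 1) (G : Set R)) (hG : ∀ r ∈ G, A r ∈ V) :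
    ∃ ls : List (List (Mat n)), ls.length = k + 1 ∧ (∀ l ∈ ls, IsCompleteWord V l) ∧
      ls.flatten.prod = finProd A G := by
  classical
  induction k generalizing G with
  | zero =>
    -- The last word takes all remaining letters, including those after its block; hence at least
    -- one block is needed.
    obtain ⟨m, -, hV, -⟩ := h
    refine ⟨[(G.sort (· ≤ ·)).map A], rfl, ?_, by simp [finProd]⟩
    intro l hl
    rw [List.mem_singleton] at hl
    subst hl
    refine ⟨by simpa using hG, fun x hx => ?_⟩
    obtain ⟨r, hr, rfl⟩ := hV hx
    exact List.mem_map_of_mem ((Finset.mem_sort _).2 hr.1)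
  | succ k ih =>
    obtain ⟨m, hm, hV, hk⟩ := h
    obtain ⟨ls, hlen, hls, e⟩ := ih (G := G.filter (m < ·))
      (hk.mono fun x hx => by simpa using hx) fun r hr => hG r (Finset.mem_filter.1 hr).1
    refine ⟨((G.filter (· ≤ m)).sort (· ≤ ·)).map A :: ls, by simp [hlen], ?_, ?_⟩
    · intro l hl
      rcases List.mem_cons.1 hl with rfl | hl
      · refine ⟨?_, fun x hx => ?_⟩
        · intro x hx
          obtain ⟨r, hr, rfl⟩ := List.mem_map.1 hx
          exact hG r (Finset.mem_filter.1 ((Finset.mem_sort _).1 hr)).1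
        · obtain ⟨r, hr, rfl⟩ := hV hx
          exact List.mem_map_of_mem ((Finset.mem_sort _).2 (Finset.mem_filter.2 hr))
      · exact hls l hl
    · rw [List.flatten_cons, List.prod_append, e]
      change finProd A (G.filter (· ≤ m)) * _ = _
      rw [← finProd_union]
      · congr 1
        ext x
        simp only [Finset.mem_union, Finset.mem_filter, ← and_or_left, le_or_gt, and_true]
      · intro a ha b hb
        exact (Finset.mem_filter.1 ha).2.trans_lt (Finset.mem_filter.1 hb).2

/-- Blocks survive enlargement: once `G₀` contains enough of them, the word of every larger finite
subset of `S` splits into that many complete words. -/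
theorem hasLimitProd_of_completeIndex_eq_top {Sig : Set (Mat n)} (hfin : Sig.Finite)
    (hCP : IsCP Sig) (hS : ∀ r ∈ S, A r ∈ Sig) (hne : S.Nonempty) (hI : completeIndex A S = ⊤)
    (hX : IsProjection (A '' S) X) : HasLimitProd A S X := by
  refine hasLimitProd_iff.2 fun U hU => ?_
  have hsub : A '' S ⊆ Sig := Set.image_subset_iff.2 hS
  obtain ⟨N, hN⟩ := hCP.exists_length_flatten_mem hfin hsub (hne.image A) hX hU
  obtain ⟨m, hm, hint⟩ := completeIndex_eq_top_iff.1 hI (N + 1)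
  obtain ⟨k, rfl⟩ : ∃ k, m = k + 1 := ⟨m - 1, by omega⟩
  obtain ⟨G₀, hG₀, hb⟩ := hint.exists_finset_hasBlocks (hfin.subset hsub)
  refine ⟨G₀, hG₀, fun G hG hGS => ?_⟩
  obtain ⟨ls, hlen, hls, e⟩ :=
    (hb.mono (Finset.coe_subset.2 hG)).exists_flatten fun r hr => ⟨r, hGS hr, rfl⟩
  rw [← e]
  exact hN ls hls (by omega)

/-- The iterative continuous product is the limit of the finite products. -/
theorem IsContProd.hasLimitProd {Sig : Set (Mat n)} (hfin : Sig.Finite) (hCP : IsCP Sig)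
    (h : IsContProd A S X) (hS : ∀ r ∈ S, A r ∈ Sig) : HasLimitProd A S X := by
  induction h with
  | finite G => exact hasLimitProd_finite G
  | proj S P hne hI hP => exact hasLimitProd_of_completeIndex_eq_top hfin hCP hS hne hI hP
  | partition S hI m T X hU hlt hinc hX ih =>
    subst hU
    exact hasLimitProd_iUnion T X hlt fun i => ih i fun r hr => hS r (Set.mem_iUnion_of_mem i hr)

/-- Induction on the number of values: each piece of an incomplete partition takes strictly fewer of
them. -/
theorem exists_isContProd {Sig : Set (Mat n)} (hfin : Sig.Finite) (hCP : IsCP Sig)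
    (hS : ∀ r ∈ S, A r ∈ Sig) : ∃ X, IsContProd A S X := by
  induction hc : (A '' S).ncard using Nat.strong_induction_on generalizing S with
  | _ c ih =>
    subst hc
    have hsub : A '' S ⊆ Sig := Set.image_subset_iff.2 hS
    rcases S.finite_or_infinite with hSfin | hSinf
    · lift S to Finset R using hSfin
      exact ⟨_, .finite S⟩
    by_cases hI : completeIndex A S = ⊤
    · obtain ⟨P, hP⟩ := exists_isProjection (hCP.transversal _ hsub)
      exact ⟨P, .proj S P hSinf.nonempty hI hP⟩
    · obtain ⟨N, hN⟩ : ∃ N, ¬ HasBlocks A (A '' S) N S := by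
        by_contra! hcon
        exact hI (completeIndex_eq_top_iff.2 fun N =>
          ⟨N, le_rfl, (hcon N).hasCompleteIntervals hSinf.nonempty⟩)
      obtain ⟨m, T, hU, hlt, hinc⟩ := hasIncompletePartition_of_not_hasBlocks
        (hfin.subset hsub) (hSinf.nonempty.image A)
        (fun r hr => hI (completeIndex_eq_top_of_image_subset_singleton hSinf hr)) hN
      have hTS : ∀ i, T i ⊆ S := fun i => hU ▸ Set.subset_iUnion T i
      choose X hX using fun i => ih _ (Set.ncard_lt_ncard
        ⟨Set.image_mono (hTS i), hinc i⟩ (hfin.subset hsub)) (fun r hr => hS r (hTS i hr)) rfl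
      exact ⟨_, .partition S hI m T X hU hlt (fun i e => hinc i e.ge) hX⟩

theorem isContProd_contProd (h : ∃ X, IsContProd A S X) : IsContProd A S (contProd A S) := by
  rw [contProd, dif_pos h]
  exact h.choose_spec

theorem existsUnique_isContProd {Sig : Set (Mat n)} (hfin : Sig.Finite) (hCP : IsCP Sig)
    (hS : ∀ r ∈ S, A r ∈ Sig) : ∃! X, IsContProd A S X := by
  obtain ⟨X, hX⟩ := exists_isContProd hfin hCP hS
  exact ⟨X, hX, fun Y hY => (hY.hasLimitProd hfin hCP hS).unique (hX.hasLimitProd hfin hCP hS)⟩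

theorem hasLimitProd_contProd {Sig : Set (Mat n)} (hfin : Sig.Finite) (hCP : IsCP Sig)
    (hS : ∀ r ∈ S, A r ∈ Sig) : HasLimitProd A S (contProd A S) :=
  (isContProd_contProd (exists_isContProd hfin hCP hS)).hasLimitProd hfin hCP hS

/-! ### Products over fibres of a monotone map -/

section Fibers

variable {Q : Type*} [LinearOrder Q] {F : R → Q} {B : Q → Mat n}

theorem hasLimitProd_preimage_finset (hF : Monotone F)
    (hB : ∀ q, HasLimitProd A (F ⁻¹' {q}) (B q)) (H : Finset Q) :
    HasLimitProd A (F ⁻¹' (H : Set Q)) (finProd B H) := by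
  classical
  induction H using Finset.induction_on_min with
  | empty => simpa using hasLimitProd_finite (A := A) ∅
  | insert q H hq ih =>
    rw [Finset.insert_eq, finProd_union (by simpa using hq), finProd_singleton, Finset.coe_union,
      Finset.coe_singleton, Set.preimage_union]
    refine (hB q).union ih fun a ha b hb => hF.reflect_lt ?_
    rw [show F a = q from ha]
    exact hq _ hb

attribute [local instance] Matrix.linftyOpNormedRing in
/-- Limits of finite products may be taken fiberwise. -/
theorem HasLimitProd.of_preimage (hF : Monotone F)
    (hB : ∀ q, HasLimitProd A (F ⁻¹' {q}) (B q)) {S' : Set Q}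
    (hX : HasLimitProd A (F ⁻¹' S') X) : HasLimitProd B S' X := by
  classical
  refine hasLimitProd_iff.2 fun U hU => ?_
  obtain ⟨C, hC, hCcl, hCU⟩ := exists_mem_nhds_isClosed_subset hU
  obtain ⟨G₀, hG₀, h⟩ := hasLimitProd_iff.1 hX C hC
  refine ⟨G₀.image F, ?_, fun H hH hHS => hCU ?_⟩
  · rw [Finset.coe_image]
    exact Set.image_subset_iff.2 hG₀
  -- The product over `H` is itself a limit of finite products over `F ⁻¹' H`. If it lay outside the
  -- closed set `C`, so would the product over `G₀ ∪ G₁`, yet containing `G₀` puts that product in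
  -- `C`.
  · by_contra hnot
    obtain ⟨G₁, hG₁, h₁⟩ := hasLimitProd_iff.1 (hasLimitProd_preimage_finset hF hB H) Cᶜ
      (hCcl.isOpen_compl.mem_nhds hnot)
    have hsub : (↑(G₀ ∪ G₁) : Set R) ⊆ F ⁻¹' (H : Set Q) := by
      rw [Finset.coe_union]
      exact Set.union_subset (fun x hx => hH (Finset.mem_image_of_mem F hx)) hG₁
    exact h₁ _ Finset.subset_union_right hsub
      (h _ Finset.subset_union_left (hsub.trans (Set.preimage_mono hHS)))

end Fibers

end ContProd

end ContinuousProduct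

open ContinuousProduct in
theorem theorem4p2 {n : ℕ} (Sig : Set (ContinuousProduct.Mat n)) (hfin : Sig.Finite)
    (hCP : ContinuousProduct.IsCP Sig)
    {R Q : Type*} [LinearOrder R] [LinearOrder Q]
    (A : R → ContinuousProduct.Mat n) (hA : ∀ r, A r ∈ Sig)
    (F : R → Q) (hF : Monotone F)
    (M' : Q → ContinuousProduct.Mat n)
    (hM' : ∀ q, M' q = ContinuousProduct.contProd A (F ⁻¹' {q})) :
    -- the continuous products `M(S)` are well defined
    (∀ S : Set R, ∃! X, ContinuousProduct.IsContProd A S X) ∧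
    -- `M'(S') = M(F⁻¹(S'))`
    ∀ S' : Set Q,
      -- the product of `M'` over `S'` as the limit of the finite products
      ContinuousProduct.HasLimitProd M' S' (ContinuousProduct.contProd A (F ⁻¹' S')) ∧
      -- and by the iterative procedure, whenever that applies to `M'` on `S'`
      ∀ Sig' : Set (ContinuousProduct.Mat n), Sig'.Finite → ContinuousProduct.IsCP Sig' →
        (∀ q ∈ S', M' q ∈ Sig') →
        (∃! X, ContinuousProduct.IsContProd M' S' X) ∧
          ContinuousProduct.contProd M' S' = ContinuousProduct.contProd A (F ⁻¹' S') := by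
  have hlim : ∀ S : Set R, HasLimitProd A S (contProd A S) := fun S =>
    hasLimitProd_contProd hfin hCP fun r _ => hA r
  refine ⟨fun S => existsUnique_isContProd hfin hCP fun r _ => hA r, fun S' => ?_⟩
  have hS' : HasLimitProd M' S' (contProd A (F ⁻¹' S')) :=
    HasLimitProd.of_preimage hF (fun q => hM' q ▸ hlim _) (hlim _)
  refine ⟨hS', fun Sig' hfin' hCP' hSig' => ⟨existsUnique_isContProd hfin' hCP' hSig', ?_⟩⟩
  exact (hasLimitProd_contProd hfin' hCP' hSig').unique hS'
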